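/- Let $E$ be a complex Banach lattice, i.e. the complexification $E = X \oplus iX$ of a real Banach lattice $X$, with modulus $|x+iy| = \sup_{\theta\in\mathbb{R}} (\cos\theta\, x + \sin\theta\, y)$, norm $\|z\| = \|\,|z|\,\|$ and positive cone $E_+ = X_+$. For $u \in E_+$ let $E_u = \{ f \in E : |f| \le c u \text{ for some real } c \ge 0 \}$ be the principal ideal generated by $u$, and let $\overline{E_u}$ be its norm closure. Let $T \colon E \to E$ be a linear operator that is - positive, i.e. $T E_+ \subseteq E_+$, and - weakly almost periodic, i.e. for every $f \in E$ the orbit $\{T^n f : n \ge 0\}$ is relatively compact in the weak topology of $E$. Suppose that for every $f \in E_+$ there is an integer $n \ge 1$ (which may depend on $f$) such that $$\overline{E_{T^n f}} \supseteq \overline{E_{T^{n-1} f}}.$$ Then every eigenvalue $\lambda \in \mathbb{C}$ of $T$ with $|\lambda| = 1$ equals $1$; that is, $\sigma_{\mathrm{pnt}}(T) \cap \mathbb{T} \subseteq \{1\}$, where $\sigma_{\mathrm{pnt}}(T)$ is the set of eigenvalues of $T$ and $\mathbb{T} = \{\lambda\in\mathbb{C} : |\lambda| = 1\}$. -/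

import Mathlib

/-! ### Complex Banach lattices

A real Banach lattice is a complete normed real vector lattice with a solid norm. A complex Banach
lattice is the complexification `E = X ⊕ iX` of a real Banach lattice `X`, with the modulus
`|x + iy| = sup {cos θ • x + sin θ • y | θ ∈ ℝ}` (the supremum exists in `X`), the norm
`‖z‖ = ‖|z|‖`, and the order given by the cone of `X`. -/

/-- The complexification `X ⊕ iX`; the pair `⟨x, y⟩` stands for `x + iy`. -/
@[ext]
structure Complexification (X : Type*) where
  /-- The real part. -/
  re : X
  /-- The imaginary part. -/
  im : X

namespace Complexification

section Algebra

variable {X : Type*} [AddCommGroup X]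

instance : Zero (Complexification X) := ⟨⟨0, 0⟩⟩
instance : Add (Complexification X) := ⟨fun z w => ⟨z.re + w.re, z.im + w.im⟩⟩
instance : Neg (Complexification X) := ⟨fun z => ⟨-z.re, -z.im⟩⟩

@[simp] theorem zero_re : (0 : Complexification X).re = 0 := rfl
@[simp] theorem zero_im : (0 : Complexification X).im = 0 := rfl
@[simp] theorem add_re (z w : Complexification X) : (z + w).re = z.re + w.re := rfl
@[simp] theorem add_im (z w : Complexification X) : (z + w).im = z.im + w.im := rfl
@[simp] theorem neg_re (z : Complexification X) : (-z).re = -z.re := rfl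
@[simp] theorem neg_im (z : Complexification X) : (-z).im = -z.im := rfl

instance : AddCommGroup (Complexification X) where
  add_assoc a b c := by ext <;> simp [add_assoc]
  zero_add a := by ext <;> simp
  add_zero a := by ext <;> simp
  add_comm a b := by ext <;> simp [add_comm]
  neg_add_cancel a := by ext <;> simp
  nsmul := nsmulRec
  zsmul := zsmulRec

@[simp] theorem sub_re (z w : Complexification X) : (z - w).re = z.re - w.re := by
  simp [sub_eq_add_neg]
@[simp] theorem sub_im (z w : Complexification X) : (z - w).im = z.im - w.im := by
  simp [sub_eq_add_neg]

/-- The embedding of the real part `X` into its complexification. -/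
def ofReal (x : X) : Complexification X := ⟨x, 0⟩

@[simp] theorem ofReal_re (x : X) : (ofReal x).re = x := rfl
@[simp] theorem ofReal_im (x : X) : (ofReal x).im = 0 := rfl

variable [Module ℝ X]

/-- `(a + ib)(x + iy) = (ax - by) + i(ay + bx)`. -/
instance : SMul ℂ (Complexification X) :=
  ⟨fun c z => ⟨c.re • z.re - c.im • z.im, c.re • z.im + c.im • z.re⟩⟩

@[simp] theorem smul_re (c : ℂ) (z : Complexification X) :
    (c • z).re = c.re • z.re - c.im • z.im := rfl
@[simp] theorem smul_im (c : ℂ) (z : Complexification X) :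
    (c • z).im = c.re • z.im + c.im • z.re := rfl

instance : Module ℂ (Complexification X) where
  one_smul z := by ext <;> simp
  mul_smul a b z := by ext <;> simp <;> module
  smul_zero a := by ext <;> simp
  smul_add a z w := by ext <;> simp <;> module
  add_smul a b z := by ext <;> simp <;> module
  zero_smul z := by ext <;> simp

end Algebra

section Order

variable {X : Type*} [PartialOrder X]

/-- `z ≤ w` means that `w - z` lies in the cone of `X`; so `0 ≤ z` iff `z` is real and positive. -/
instance : PartialOrder (Complexification X) where
  le z w := z.re ≤ w.re ∧ z.im = w.im
  le_refl z := ⟨le_rfl, rfl⟩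
  le_trans _ _ _ h k := ⟨h.1.trans k.1, h.2.trans k.2⟩
  le_antisymm _ _ h k := Complexification.ext (h.1.antisymm k.1) h.2

theorem le_def (z w : Complexification X) : z ≤ w ↔ z.re ≤ w.re ∧ z.im = w.im := Iff.rfl

end Order

section Banach

theorem smul_le_abs_smul_abs {X : Type*} [AddCommGroup X] [Lattice X] [IsOrderedAddMonoid X]
    [Module ℝ X] [IsOrderedModule ℝ X] (a : ℝ) (x : X) : a • x ≤ |a| • |x| := by
  rcases le_total 0 a with h | h
  · rw [abs_of_nonneg h]; exact smul_le_smul_of_nonneg_left (le_abs_self x) h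
  · rw [abs_of_nonpos h]
    calc a • x = (-a) • (-x) := by simp
      _ ≤ (-a) • |x| := smul_le_smul_of_nonneg_left (neg_le_abs x) (by linarith)

variable {X : Type*} [NormedAddCommGroup X] [NormedSpace ℝ X] [Lattice X] [IsOrderedAddMonoid X]
  [IsOrderedModule ℝ X]

/-- The real part of `e^{-iθ} (x + iy)`. -/
noncomputable def rot (z : Complexification X) (θ : ℝ) : X := Real.cos θ • z.re + Real.sin θ • z.im

theorem rot_le_rot_add (z : Complexification X) (θ η : ℝ) :
    z.rot θ ≤ z.rot η + |θ - η| • (|z.re| + |z.im|) := by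
  have hc : |Real.cos θ - Real.cos η| ≤ |θ - η| := by
    have := Real.abs_cos_sub_cos_le θ η
    exact this
  have hs : |Real.sin θ - Real.sin η| ≤ |θ - η| := by
    have := Real.abs_sin_sub_sin_le θ η
    exact this
  have h1 := (smul_le_abs_smul_abs (Real.cos θ - Real.cos η) z.re).trans
    (smul_le_smul_of_nonneg_right hc (abs_nonneg _))
  have h2 := (smul_le_abs_smul_abs (Real.sin θ - Real.sin η) z.im).trans
    (smul_le_smul_of_nonneg_right hs (abs_nonneg _))
  have h3 : z.rot θ = z.rot η + ((Real.cos θ - Real.cos η) • z.re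
      + (Real.sin θ - Real.sin η) • z.im) := by
    simp only [rot]; module
  rw [h3, smul_add]
  gcongr

variable [HasSolidNorm X]

/-- In a real Banach lattice the supremum that defines the modulus exists. -/
theorem exists_isLUB_rot [CompleteSpace X] (z : Complexification X) :
    ∃ m : X, IsLUB (Set.range z.rot) m := by
  set u : X := |z.re| + |z.im| with hu
  have hu0 : 0 ≤ u := add_nonneg (abs_nonneg _) (abs_nonneg _)
  let s : ℕ → X := fun n =>
    (Finset.range (7 * (n + 1) + 1)).sup' ⟨0, by simp⟩ fun k => z.rot (k / (n + 1))
  have key : ∀ (n : ℕ) (θ : ℝ), z.rot θ ≤ s n + (1 / ((n : ℝ) + 1)) • u := by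
    intro n θ
    obtain ⟨η, ⟨h0, h7⟩, hη⟩ : ∃ η : ℝ, (0 ≤ η ∧ η ≤ 7) ∧ z.rot θ = z.rot η := by
      refine ⟨toIcoMod Real.two_pi_pos 0 θ, ?_, ?_⟩
      · have h := toIcoMod_mem_Ico Real.two_pi_pos 0 θ
        have := Real.pi_lt_d2
        exact ⟨h.1, by linarith [h.2]⟩
      · have h : toIcoMod Real.two_pi_pos 0 θ
            = θ - toIcoDiv Real.two_pi_pos 0 θ * (2 * Real.pi) := by
          rw [toIcoMod, zsmul_eq_mul]
        rw [h, rot, rot, Real.cos_sub_int_mul_two_pi, Real.sin_sub_int_mul_two_pi]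
    have hn : (0 : ℝ) < n + 1 := by positivity
    set k := ⌊η * (n + 1)⌋₊ with hk
    have hk1 : (k : ℝ) ≤ η * (n + 1) := Nat.floor_le (by positivity)
    have hk2 : η * (n + 1) < k + 1 := Nat.lt_floor_add_one _
    have hkm : k ∈ Finset.range (7 * (n + 1) + 1) := by
      rw [Finset.mem_range]
      have : (k : ℝ) ≤ 7 * (n + 1) := hk1.trans (by gcongr)
      have : k ≤ 7 * (n + 1) := by exact_mod_cast this
      omega
    have habs : |η - k / (n + 1)| ≤ 1 / ((n : ℝ) + 1) := by
      rw [show η - k / (n + 1) = (η * (n + 1) - k) / ((n : ℝ) + 1) by field_simp,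
        abs_of_nonneg (by apply div_nonneg <;> linarith)]
      gcongr
      linarith
    calc z.rot θ = z.rot η := hη
      _ ≤ z.rot (k / (n + 1)) + |η - k / (n + 1)| • u := rot_le_rot_add z _ _
      _ ≤ s n + (1 / ((n : ℝ) + 1)) • u :=
        add_le_add (Finset.le_sup' (fun k : ℕ => z.rot ((k : ℝ) / ((n : ℝ) + 1))) hkm)
          (smul_le_smul_of_nonneg_right habs hu0)
  have hs : ∀ m n, s m ≤ s n + (1 / ((n : ℝ) + 1)) • u := fun m n =>
    Finset.sup'_le _ _ fun k _ => key n _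
  have hdist : ∀ N m n : ℕ, N ≤ m → N ≤ n → dist (s m) (s n) ≤ 1 / ((N : ℝ) + 1) * ‖u‖ := by
    intro N m n hm hn
    have hb : ∀ a : ℕ, N ≤ a → (1 / ((a : ℝ) + 1)) • u ≤ (1 / ((N : ℝ) + 1)) • u := fun a ha =>
      smul_le_smul_of_nonneg_right (one_div_le_one_div_of_le (by positivity) (by gcongr)) hu0
    have h1 : |s m - s n| ≤ |(1 / ((N : ℝ) + 1)) • u| := by
      refine le_trans (abs_le'.2 ⟨?_, ?_⟩) (le_abs_self _)
      · rw [sub_le_iff_le_add']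
        exact (hs m n).trans (add_le_add_right (hb n hn) _)
      · rw [neg_sub, sub_le_iff_le_add']
        exact (hs n m).trans (add_le_add_right (hb m hm) _)
    rw [dist_eq_norm]
    refine (HasSolidNorm.solid h1).trans_eq ?_
    rw [norm_smul, Real.norm_of_nonneg (by positivity)]
  have h0 : Filter.Tendsto (fun n : ℕ => 1 / ((n : ℝ) + 1)) Filter.atTop (nhds 0) :=
    tendsto_one_div_add_atTop_nhds_zero_nat
  have hc : CauchySeq s := by
    refine cauchySeq_of_le_tendsto_0 (fun N : ℕ => 1 / ((N : ℝ) + 1) * ‖u‖)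
      (fun n m N hn hm => hdist N n m hn hm) ?_
    simpa using h0.mul_const ‖u‖
  obtain ⟨m, hm⟩ := cauchySeq_tendsto_of_complete hc
  refine ⟨m, ?_, ?_⟩
  · rintro _ ⟨θ, rfl⟩
    have := hm.add (h0.smul_const u)
    rw [zero_smul, add_zero] at this
    exact ge_of_tendsto' this fun n => key n θ
  · intro b hb
    exact le_of_tendsto' hm fun n => Finset.sup'_le _ _ fun k _ => hb ⟨_, rfl⟩

variable [CompleteSpace X]

/-- The modulus `|x + iy| = sup {cos θ • x + sin θ • y | θ ∈ ℝ}`, as an element of `X`. -/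
noncomputable def modulus (z : Complexification X) : X := (exists_isLUB_rot z).choose

theorem isLUB_modulus (z : Complexification X) : IsLUB (Set.range z.rot) z.modulus :=
  (exists_isLUB_rot z).choose_spec

theorem rot_le_modulus (z : Complexification X) (θ : ℝ) : z.rot θ ≤ z.modulus :=
  (isLUB_modulus z).1 ⟨θ, rfl⟩

theorem modulus_le {z : Complexification X} {b : X} (h : ∀ θ, z.rot θ ≤ b) : z.modulus ≤ b :=
  (isLUB_modulus z).2 (by rintro _ ⟨θ, rfl⟩; exact h θ)

theorem abs_re_le_modulus (z : Complexification X) : |z.re| ≤ z.modulus :=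
  abs_le'.2 ⟨by simpa [rot] using rot_le_modulus z 0,
    by simpa [rot] using rot_le_modulus z Real.pi⟩

theorem abs_im_le_modulus (z : Complexification X) : |z.im| ≤ z.modulus :=
  abs_le'.2 ⟨by simpa [rot] using rot_le_modulus z (Real.pi / 2),
    by simpa [rot] using rot_le_modulus z (-(Real.pi / 2))⟩

theorem modulus_nonneg (z : Complexification X) : 0 ≤ z.modulus :=
  (abs_nonneg _).trans (abs_re_le_modulus z)

theorem modulus_le_abs_add_abs (z : Complexification X) : z.modulus ≤ |z.re| + |z.im| := by
  refine modulus_le fun θ => add_le_add ?_ ?_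
  · exact (smul_le_abs_smul_abs _ _).trans <|
      (smul_le_smul_of_nonneg_right (Real.abs_cos_le_one θ) (abs_nonneg _)).trans_eq (one_smul _ _)
  · exact (smul_le_abs_smul_abs _ _).trans <|
      (smul_le_smul_of_nonneg_right (Real.abs_sin_le_one θ) (abs_nonneg _)).trans_eq (one_smul _ _)

theorem modulus_add_le (z w : Complexification X) :
    (z + w).modulus ≤ z.modulus + w.modulus := by
  refine modulus_le fun θ => ?_
  have : (z + w).rot θ = z.rot θ + w.rot θ := by simp only [rot, add_re, add_im]; module
  rw [this]
  exact add_le_add (rot_le_modulus z θ) (rot_le_modulus w θ)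

theorem modulus_smul_le (c : ℂ) (z : Complexification X) :
    (c • z).modulus ≤ ‖c‖ • z.modulus := by
  refine modulus_le fun θ => ?_
  have : (c • z).rot θ = ‖c‖ • z.rot (θ - c.arg) := by
    have h1 := Complex.norm_mul_cos_arg c
    have h2 := Complex.norm_mul_sin_arg c
    simp only [rot, smul_re, smul_im, Real.cos_sub, Real.sin_sub]
    rw [← h1, ← h2]
    module
  rw [this]
  exact smul_le_smul_of_nonneg_left (rot_le_modulus z _) (norm_nonneg c)

/-- On the real part the modulus is the usual absolute value. -/
theorem modulus_ofReal (x : X) : (ofReal x).modulus = |x| :=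
  le_antisymm (by simpa using modulus_le_abs_add_abs (ofReal x)) (abs_re_le_modulus (ofReal x))

/-- `‖z‖ = ‖|z|‖`. -/
noncomputable instance : Norm (Complexification X) := ⟨fun z => ‖z.modulus‖⟩

theorem norm_def (z : Complexification X) : ‖z‖ = ‖z.modulus‖ := rfl

theorem norm_le_norm_of_modulus_le {z : Complexification X} {b : X} (h : z.modulus ≤ b) :
    ‖z‖ ≤ ‖b‖ :=
  HasSolidNorm.solid ((abs_of_nonneg (modulus_nonneg z)).trans_le (h.trans (le_abs_self b)))

theorem norm_re_le (z : Complexification X) : ‖z.re‖ ≤ ‖z‖ :=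
  HasSolidNorm.solid ((abs_re_le_modulus z).trans (le_abs_self _))

theorem norm_im_le (z : Complexification X) : ‖z.im‖ ≤ ‖z‖ :=
  HasSolidNorm.solid ((abs_im_le_modulus z).trans (le_abs_self _))

theorem norm_le_norm_add_norm (z : Complexification X) : ‖z‖ ≤ ‖z.re‖ + ‖z.im‖ := by
  refine (norm_le_norm_of_modulus_le (modulus_le_abs_add_abs z)).trans ?_
  refine (norm_add_le _ _).trans_eq ?_
  rw [norm_abs_eq_norm, norm_abs_eq_norm]

theorem norm_smul_le_aux (c : ℂ) (z : Complexification X) : ‖c • z‖ ≤ ‖c‖ * ‖z‖ := by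
  refine (norm_le_norm_of_modulus_le (modulus_smul_le c z)).trans_eq ?_
  rw [norm_smul, norm_norm, norm_def]

theorem normedSpaceCore : NormedSpace.Core ℂ (Complexification X) where
  norm_nonneg z := norm_nonneg z.modulus
  norm_smul c z := by
    refine le_antisymm (norm_smul_le_aux c z) ?_
    rcases eq_or_ne c 0 with rfl | hc
    · rw [norm_zero, zero_mul]
      exact norm_nonneg ((0 : ℂ) • z).modulus
    · have h := norm_smul_le_aux c⁻¹ (c • z)
      rw [smul_smul, inv_mul_cancel₀ hc, one_smul, norm_inv] at h
      have hc' : 0 < ‖c‖ := norm_pos_iff.2 hc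
      calc ‖c‖ * ‖z‖ ≤ ‖c‖ * (‖c‖⁻¹ * ‖c • z‖) := by gcongr
        _ = ‖c • z‖ := by field_simp
  norm_triangle z w :=
    (norm_le_norm_of_modulus_le (modulus_add_le z w)).trans (norm_add_le _ _)
  norm_eq_zero_iff z := by
    constructor
    · intro h
      have h1 := norm_re_le z
      have h2 := norm_im_le z
      rw [h, norm_le_zero_iff] at h1 h2
      exact Complexification.ext h1 h2
    · rintro rfl
      have h := norm_le_norm_add_norm (0 : Complexification X)
      simp only [zero_re, zero_im, norm_zero, add_zero] at h
      exact le_antisymm h (norm_nonneg (0 : Complexification X).modulus)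

noncomputable instance : NormedAddCommGroup (Complexification X) :=
  NormedAddCommGroup.ofCore normedSpaceCore

noncomputable instance : NormedSpace ℂ (Complexification X) where
  norm_smul_le := norm_smul_le_aux

/-- The complexification of a Banach lattice is a Banach space. -/
instance : CompleteSpace (Complexification X) := by
  have key : ∀ (g : Complexification X → X), (∀ z w, g z - g w = g (z - w)) →
      (∀ z, ‖g z‖ ≤ ‖z‖) → ∀ f : ℕ → Complexification X, CauchySeq f →
      ∃ a, Filter.Tendsto (fun n => ‖g (f n) - a‖) Filter.atTop (nhds 0) := by
    intro g hg hn f hf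
    have hgl : LipschitzWith 1 g := LipschitzWith.of_dist_le_mul fun z w => by
      rw [dist_eq_norm, dist_eq_norm, hg, NNReal.coe_one, one_mul]
      exact hn _
    obtain ⟨a, ha⟩ := cauchySeq_tendsto_of_complete (hgl.uniformContinuous.comp_cauchySeq hf)
    exact ⟨a, tendsto_iff_norm_sub_tendsto_zero.1 ha⟩
  refine Metric.complete_of_cauchySeq_tendsto fun f hf => ?_
  obtain ⟨a, ha⟩ := key re (fun z w => (sub_re z w).symm) norm_re_le f hf
  obtain ⟨b, hb⟩ := key im (fun z w => (sub_im z w).symm) norm_im_le f hf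
  refine ⟨⟨a, b⟩, tendsto_iff_norm_sub_tendsto_zero.2 ?_⟩
  have hab := ha.add hb
  rw [add_zero] at hab
  refine squeeze_zero (fun n => norm_nonneg _) (fun n => ?_) hab
  have h := norm_le_norm_add_norm (f n - ⟨a, b⟩)
  rwa [sub_re, sub_im] at h

/-- The principal ideal `E_u = {f | ∃ c ≥ 0, |f| ≤ c u}` generated by a positive element `u`. -/
def principalIdeal (u : Complexification X) : Set (Complexification X) :=
  {f | ∃ c : ℝ, 0 ≤ c ∧ ofReal f.modulus ≤ (c : ℂ) • u}

end Banach

end Complexification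

/-- All orbits `{T ^ n f | n ≥ 0}` are relatively compact in the weak topology. -/
def IsWeaklyAlmostPeriodic {E : Type*} [NormedAddCommGroup E] [NormedSpace ℂ E]
    (T : Module.End ℂ E) : Prop :=
  ∀ f : E, IsCompact (closure (toWeakSpace ℂ E '' Set.range fun n : ℕ => (T ^ n) f))

/-- The set of eigenvalues of `T`. -/
def pointSpectrum {E : Type*} [AddCommGroup E] [Module ℂ E] (T : Module.End ℂ E) : Set ℂ :=
  {l | T.HasEigenvalue l}

open Filter Topology

/-! Let `T z = l • z` with `‖l‖ = 1` and `l ≠ 1`, let `S` be the restriction of `T` to `X`, and put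
`r ν = re (ν z)` and `m = |z|`. Then `S (r ν) = r (l ν)` and `m ≤ S m`. Continuity of `T` is not
assumed: weak almost periodicity bounds each orbit, and positivity upgrades this to power
boundedness. Hence `S ^ n m` increases in norm to a fixed vector `u ≥ m` (`exists_fixed_of_le_map`).

Take `c = ‖1 + l‖ / 2 < 1` and `w ν = (r ν - c u)⁺`. For unit `ν`, the bound `r ν + r (l ν) = r ((1
+ l) ν) ≤ 2 c u` makes `w ν` and `w (l ν)` disjoint. Recurrence of the powers of `l` gives limits `h
ν ≥ w ν` of `S ^ n (w ν)` along an ultrafilter, with `S (h ν) = h (l ν)`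
(`exists_equivariant_limit`).

The ideal condition, applied to `h ν`, puts some `h (l ^ n ν)` in the closed ideal generated by `h
(l ^ (n + 1) ν)`. Disjointness of the `w`'s, carried to the limit by `S ^ n`, forces `h (l ^ n ν) =
0`, and recurrence then gives `h ν = 0`. So `r ν ≤ c u` for all unit `ν`, whence `m ≤ c u`, `u ≤ c
u`, and finally `u = m = 0` (`eq_zero_of_intertwining`). -/

theorem posPart_sub_posPart_le {X : Type*} [AddCommGroup X] [Lattice X] [IsOrderedAddMonoid X]
    (a b : X) : a⁺ - b⁺ ≤ (a - b)⁺ := by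
  rw [sub_le_iff_le_add]
  refine sup_le ?_ (add_nonneg (posPart_nonneg _) (posPart_nonneg _))
  calc a = (a - b) + b := by abel
    _ ≤ (a - b)⁺ + b⁺ := add_le_add (le_posPart _) (le_posPart _)

/-- If `a + b ≤ 0` then the positive parts of `a` and `b` are disjoint, even after scaling. -/
theorem nonpos_of_le_posPart_of_le_smul_posPart {X : Type*} [AddCommGroup X] [Lattice X]
    [IsOrderedAddMonoid X] [Module ℝ X] [IsOrderedModule ℝ X] {a b e : X} {t : ℝ} (ht : 0 ≤ t)
    (hab : a + b ≤ 0) (h₁ : e ≤ a⁺) (h₂ : e ≤ t • b⁺) : e ≤ 0 := by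
  -- The factor `t + 1` dominates both coefficients `1` and `t` and is invertible even when `t = 0`.
  have hs : 0 < t + 1 := by linarith
  have h3 : e ≤ (t + 1) • b⁻ := by
    refine h₁.trans ?_
    have h4 : a⁺ ≤ b⁻ := by
      rw [← posPart_neg]
      exact posPart_mono (by rwa [le_neg_iff_add_nonpos_right])
    refine h4.trans ?_
    rw [add_smul, one_smul]
    exact le_add_of_nonneg_left (smul_nonneg ht (negPart_nonneg _))
  have h5 : e ≤ (t + 1) • b⁺ := h₂.trans <|
    smul_le_smul_of_nonneg_right (by linarith) (posPart_nonneg _)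
  have h6 : (t + 1)⁻¹ • e ≤ b⁺ ⊓ b⁻ :=
    le_inf ((inv_smul_le_iff_of_pos hs).2 h5) ((inv_smul_le_iff_of_pos hs).2 h3)
  rw [posPart_inf_negPart_eq_zero, inv_smul_le_iff_of_pos hs, smul_zero] at h6
  exact h6

theorem norm_le_norm_of_nonneg_of_le {X : Type*} [NormedAddCommGroup X] [Lattice X]
    [IsOrderedAddMonoid X] [HasSolidNorm X] {a b : X} (ha : 0 ≤ a) (hab : a ≤ b) : ‖a‖ ≤ ‖b‖ :=
  norm_le_norm_of_abs_le_abs (by rwa [abs_of_nonneg ha, abs_of_nonneg (ha.trans hab)])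

theorem abs_map_le_map_abs {X : Type*} [AddCommGroup X] [Lattice X] [IsOrderedAddMonoid X]
    [Module ℝ X] {S : X →ₗ[ℝ] X} (hS : Monotone S) (x : X) : |S x| ≤ S |x| :=
  abs_le'.2 ⟨hS (le_abs_self x), by rw [← map_neg]; exact hS (neg_le_abs x)⟩

theorem monotone_end_pow {X : Type*} [AddCommGroup X] [PartialOrder X] [Module ℝ X]
    {S : X →ₗ[ℝ] X} (hS : Monotone S) (n : ℕ) : Monotone (S ^ n) := by
  rw [Module.End.coe_pow]
  exact hS.iterate n

/-! ### Uniform boundedness and monotone convergence in a real Banach lattice -/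

section

variable {X : Type*} [NormedAddCommGroup X] [NormedSpace ℝ X] [Lattice X]
    [IsOrderedAddMonoid X] [IsOrderedModule ℝ X] [HasSolidNorm X]

/-- A pointwise bounded family of positive operators on a Banach lattice is uniformly bounded. -/
theorem exists_forall_norm_le_of_monotone [CompleteSpace X] {ι : Type*} {S : ι → X →ₗ[ℝ] X}
    (hS : ∀ i, Monotone (S i)) (hb : ∀ x, ∃ C, ∀ i, ‖S i x‖ ≤ C) :
    ∃ C, ∀ i x, ‖S i x‖ ≤ C * ‖x‖ := by
  by_contra! hcon
  -- Gliding hump: the `y k` are positive and summable, so each lies below their sum; positivity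
  -- then bounds `S (i k) (y k)` by the image of that single vector.
  have hseq : ∀ k : ℕ, ∃ i y, 0 ≤ y ∧ ‖y‖ ≤ (1 / 2 : ℝ) ^ k ∧ (k : ℝ) ≤ ‖S i y‖ := by
    intro k
    obtain ⟨i, x, hx⟩ := hcon (k * 2 ^ k)
    have hx0 : 0 < ‖x‖ := by
      refine norm_pos_iff.2 ?_
      rintro rfl
      simp at hx
    have habs : ‖S i x‖ ≤ ‖S i |x|‖ :=
      norm_le_norm_of_abs_le_abs ((abs_map_le_map_abs (hS i) x).trans (le_abs_self _))
    have ht : 0 < (1 / 2 : ℝ) ^ k * ‖x‖⁻¹ := by positivity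
    refine ⟨i, ((1 / 2 : ℝ) ^ k * ‖x‖⁻¹) • |x|, smul_nonneg ht.le (abs_nonneg _), ?_, ?_⟩
    · rw [norm_smul, norm_abs_eq_norm, Real.norm_of_nonneg ht.le, mul_assoc,
        inv_mul_cancel₀ hx0.ne', mul_one]
    · rw [map_smul, norm_smul, Real.norm_of_nonneg ht.le]
      calc (k : ℝ) = (1 / 2 : ℝ) ^ k * ‖x‖⁻¹ * (k * 2 ^ k * ‖x‖) := by
            rw [one_div, inv_pow]
            field_simp
        _ ≤ _ := by gcongr; exact hx.le.trans habs
  choose i y hy0 hy1 hy2 using hseq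
  have hsum : Summable y := Summable.of_norm_bounded summable_geometric_two hy1
  obtain ⟨C, hC⟩ := hb (∑' k, y k)
  obtain ⟨k, hk⟩ := exists_nat_gt C
  have hle : y k ≤ ∑' k, y k := hsum.le_tsum k fun j _ => hy0 j
  have h0 : 0 ≤ S (i k) (y k) := by simpa using hS (i k) (hy0 k)
  have := norm_le_norm_of_nonneg_of_le h0 (hS (i k) hle)
  linarith [hC (i k), hy2 k]

/-- An increasing sequence in a Banach lattice with a weak cluster point converges in norm. -/
theorem tendsto_atTop_of_monotone_of_weak_limit {a : ℕ → X} (ha : Monotone a) {U : Ultrafilter ℕ}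
    (hU : (U : Filter ℕ) ≤ atTop) {h : X}
    (hw : ∀ φ : StrongDual ℝ X, Tendsto (fun n => φ (a n)) U (𝓝 (φ h))) :
    Tendsto a atTop (𝓝 h) := by
  -- The closed convex set `Ici (a n)` contains a tail of the sequence, so it contains the weak
  -- limit.
  have hle : ∀ n, a n ≤ h := by
    intro n
    by_contra hn
    obtain ⟨φ, s, h1, h2⟩ := geometric_hahn_banach_point_closed (convex_Ici (𝕜 := ℝ) (a n))
      isClosed_Ici (x := h) hn
    refine absurd (ge_of_tendsto (hw φ) (b := s) ?_) (not_le.2 h1)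
    filter_upwards [hU (eventually_ge_atTop n)] with m hm
    exact (h2 _ (ha hm)).le
  have hmem : h ∈ closure (convexHull ℝ (Set.range a)) := by
    by_contra hn
    obtain ⟨φ, s, h1, h2⟩ := geometric_hahn_banach_point_closed
      ((convex_convexHull ℝ (Set.range a)).closure) isClosed_closure hn
    exact absurd (ge_of_tendsto' (hw φ) fun n => (h2 _ (subset_closure
      (subset_convexHull ℝ _ ⟨n, rfl⟩))).le) (not_le.2 h1)
  -- By monotonicity every convex combination `y` lies below some `a N`, so `0 ≤ h - a n ≤ h - y`
  -- for `n ≥ N`. Mazur's approximation of `h` by such `y` thus passes to the sequence.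
  have hsub : convexHull ℝ (Set.range a) ⊆ ⋃ n, Set.Iic (a n) := by
    refine convexHull_min (by rintro _ ⟨n, rfl⟩; exact Set.mem_iUnion.2 ⟨n, le_rfl⟩) ?_
    exact Directed.convex_iUnion (Monotone.directed_le fun m n hmn =>
      Set.Iic_subset_Iic.2 (ha hmn)) fun n => convex_Iic (a n)
  rw [Metric.tendsto_atTop]
  intro ε hε
  obtain ⟨y, hy, hyd⟩ := Metric.mem_closure_iff.1 hmem ε hε
  obtain ⟨N, hN⟩ := Set.mem_iUnion.1 (hsub hy)
  refine ⟨N, fun n hn => ?_⟩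
  rw [dist_comm]
  refine lt_of_le_of_lt ?_ hyd
  rw [dist_eq_norm, dist_eq_norm]
  exact norm_le_norm_of_nonneg_of_le (sub_nonneg.2 (hle n))
    (sub_le_sub_left (le_trans hN (ha hn)) _)

end

/-! ### Recurrence and the argument on the real lattice -/

/-- In the compact group `Circle` the identity is a cluster point of the powers of any element. -/
theorem exists_ultrafilter_tendsto_pow_one {l : ℂ} (hl : ‖l‖ = 1) :
    ∃ U : Ultrafilter ℕ, (U : Filter ℕ) ≤ atTop ∧ Tendsto (fun n => l ^ n) U (𝓝 1) := by
  let x : Circle := ⟨l, by simp [Submonoid.unitSphere, hl]⟩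
  obtain ⟨U, hU, h⟩ := mapClusterPt_iff_ultrafilter.1 (mapClusterPt_one_atTop_pow x)
  refine ⟨U, hU, ?_⟩
  have := (continuous_subtype_val.tendsto (1 : Circle)).comp h
  refine this.congr fun n => ?_
  exact Circle.coe_pow x n

theorem abs_posPart_sub_posPart_le {X : Type*} [AddCommGroup X] [Lattice X]
    [IsOrderedAddMonoid X] [Module ℝ X] [IsOrderedModule ℝ X] {r : ℂ →ₗ[ℝ] X} {u : X} (hu : 0 ≤ u)
    (hr : ∀ ν, r ν ≤ ‖ν‖ • u) (c : ℝ) (ν μ : ℂ) :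
    |(r ν - c • u)⁺ - (r μ - c • u)⁺| ≤ ‖ν - μ‖ • u := by
  have key : ∀ ν μ : ℂ, (r ν - c • u)⁺ - (r μ - c • u)⁺ ≤ ‖ν - μ‖ • u := fun ν μ => by
    refine (posPart_sub_posPart_le _ _).trans (sup_le ?_ (smul_nonneg (norm_nonneg _) hu))
    rw [sub_sub_sub_cancel_right, ← map_sub]
    exact hr _
  refine abs_le'.2 ⟨key ν μ, ?_⟩
  rw [neg_sub, norm_sub_rev]
  exact key μ ν

section

variable {X : Type*} [NormedAddCommGroup X] [NormedSpace ℝ X] [Lattice X]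
    [IsOrderedAddMonoid X] [IsOrderedModule ℝ X] [HasSolidNorm X]

/-- A subinvariant vector of a power bounded positive operator whose orbit has a weak cluster
point is dominated by a fixed vector, the limit of its orbit. -/
theorem exists_fixed_of_le_map {S : X →ₗ[ℝ] X} (hS : Monotone S) {C : ℝ}
    (hC : ∀ n x, ‖(S ^ n) x‖ ≤ C * ‖x‖) {m : X} (hm : m ≤ S m)
    (hw : ∀ U : Ultrafilter ℕ, ∃ h : X, ∀ φ : StrongDual ℝ X,
      Tendsto (fun n => φ ((S ^ n) m)) U (𝓝 (φ h))) :
    ∃ u, m ≤ u ∧ S u = u ∧ Tendsto (fun n => (S ^ n) m) atTop (𝓝 u) := by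
  have hmono : Monotone fun n => (S ^ n) m := monotone_nat_of_le_succ fun n => by
    rw [pow_succ, Module.End.mul_apply]
    exact monotone_end_pow hS n hm
  obtain ⟨U, hU⟩ := Ultrafilter.exists_le (atTop : Filter ℕ)
  obtain ⟨u, hu⟩ := hw U
  have hlim : Tendsto (fun n => (S ^ n) m) atTop (𝓝 u) :=
    tendsto_atTop_of_monotone_of_weak_limit hmono hU hu
  have hcont : Continuous S := by
    refine AddMonoidHomClass.continuous_of_bound S C fun x => ?_
    simpa using hC 1 x
  refine ⟨u, by simpa using hmono.ge_of_tendsto hlim 0, ?_, hlim⟩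
  refine tendsto_nhds_unique ((hcont.tendsto u).comp hlim)
    (((tendsto_add_atTop_iff_nat 1).2 hlim).congr fun n => ?_)
  rw [pow_succ', Module.End.mul_apply, Function.comp_apply]

/-- Let `r` intertwine multiplication by a unimodular `l` with the positive operator `S`, and let
`r` be dominated by a fixed vector `u` of `S`. Then `S ^ n (r (l ^ (-n) ν) - c u)⁺` converges to
some `h ν` on which `S` acts as multiplication of `ν` by `l`. -/
theorem exists_equivariant_limit {S : X →ₗ[ℝ] X} (hS : Monotone S) {C : ℝ}
    (hC : ∀ n x, ‖(S ^ n) x‖ ≤ C * ‖x‖)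
    (hwap : ∀ x, ∀ U : Ultrafilter ℕ, ∃ h : X, ∀ φ : StrongDual ℝ X,
      Tendsto (fun n => φ ((S ^ n) x)) U (𝓝 (φ h)))
    {l : ℂ} (hl : ‖l‖ = 1) {U : Ultrafilter ℕ} (hU : (U : Filter ℕ) ≤ atTop)
    (hlU : Tendsto (fun n => l ^ n) U (𝓝 1))
    {r : ℂ →ₗ[ℝ] X} (hSr : ∀ ν, S (r ν) = r (l * ν)) {u : X} (hu : 0 ≤ u) (hSu : S u = u)
    (hru : ∀ ν, r ν ≤ ‖ν‖ • u) (c : ℝ) :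
    ∃ h : ℂ → X, (∀ ν, (r ν - c • u)⁺ ≤ h ν) ∧ (∀ n ν, (S ^ n) (h ν) = h (l ^ n * ν)) ∧
      (∀ ν, Tendsto (fun n => (S ^ n) (h ν)) U (𝓝 (h ν))) ∧
      ∀ ν, Tendsto (fun n => (S ^ n) (r ν - c • u)⁺) U (𝓝 (h ν)) := by
  have hl0 : l ≠ 0 := by rintro rfl; simp at hl
  set w : ℂ → X := fun ν => (r ν - c • u)⁺ with hw
  have hwd : ∀ ν μ, |w ν - w μ| ≤ ‖ν - μ‖ • u := abs_posPart_sub_posPart_le hu hru c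
  have hSnu : ∀ n, (S ^ n) u = u := fun n => by
    induction n with
    | zero => simp
    | succ n ih => rw [pow_succ, Module.End.mul_apply, hSu, ih]
  have hSnw : ∀ n ν μ, |(S ^ n) (w ν) - (S ^ n) (w μ)| ≤ ‖ν - μ‖ • u := fun n ν μ => by
    rw [← map_sub]
    refine (abs_map_le_map_abs (monotone_end_pow hS n) _).trans ?_
    refine (monotone_end_pow hS n (hwd ν μ)).trans_eq ?_
    rw [map_smul, hSnu]
  have hSw : ∀ ν, w (l * ν) ≤ S (w ν) := fun ν => by
    refine sup_le ?_ ?_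
    · have := hS (le_posPart (r ν - c • u))
      rwa [map_sub, map_smul, hSr, hSu] at this
    · simpa using hS (posPart_nonneg (r ν - c • u))
  -- Untwisting by `l ^ n` makes the orbit increasing, since `w (l ν) ≤ S (w ν)`. Along `U` the
  -- twist tends to `1`, so the weak limit of `S ^ n (w ν)` is also one of `a ν`, and monotonicity
  -- makes it a norm limit.
  set a : ℂ → ℕ → X := fun ν n => (S ^ n) (w ((l ^ n)⁻¹ * ν)) with ha
  have hmono : ∀ ν, Monotone (a ν) := fun ν => monotone_nat_of_le_succ fun n => by
    simp only [ha]
    rw [pow_succ S, Module.End.mul_apply]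
    refine monotone_end_pow hS n (le_trans (le_of_eq ?_) (hSw _))
    congr 1
    rw [pow_succ]
    field_simp
  have hinv : Tendsto (fun n => (l ^ n)⁻¹) U (𝓝 1) := by
    simpa using hlU.inv₀ one_ne_zero
  have hdiff : ∀ ν, Tendsto (fun n => a ν n - (S ^ n) (w ν)) U (𝓝 0) := fun ν => by
    have hb : Tendsto (fun n => ‖(l ^ n)⁻¹ * ν - ν‖ * ‖u‖) U (𝓝 0) := by
      have := (((hinv.mul_const ν).sub_const ν).norm).mul_const ‖u‖
      simpa using this
    refine squeeze_zero_norm (fun n => ?_) hb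
    have := norm_le_norm_of_abs_le_abs ((hSnw n ((l ^ n)⁻¹ * ν) ν).trans (le_abs_self _))
    rwa [norm_smul, norm_norm] at this
  have hex : ∀ ν, ∃ h, Tendsto (a ν) atTop (𝓝 h) := fun ν => by
    obtain ⟨h, hh⟩ := hwap (w ν) U
    refine ⟨h, tendsto_atTop_of_monotone_of_weak_limit (hmono ν) hU fun φ => ?_⟩
    have := ((φ.continuous.tendsto 0).comp (hdiff ν)).add (hh φ)
    simpa [Function.comp_def] using this
  choose h hh using hex
  have hcont : Continuous S := by
    refine AddMonoidHomClass.continuous_of_bound S C fun x => ?_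
    simpa using hC 1 x
  have hSh : ∀ ν, S (h ν) = h (l * ν) := fun ν => by
    refine tendsto_nhds_unique ((hcont.tendsto _).comp (hh ν))
      (((tendsto_add_atTop_iff_nat 1).2 (hh (l * ν))).congr fun n => ?_)
    simp only [ha, Function.comp_apply]
    rw [pow_succ' S, Module.End.mul_apply]
    congr 3
    rw [pow_succ]
    field_simp
  have hSnh : ∀ n ν, (S ^ n) (h ν) = h (l ^ n * ν) := fun n => by
    induction n with
    | zero => simp
    | succ n ih =>
      intro ν
      rw [pow_succ, Module.End.mul_apply, hSh, ih, pow_succ, mul_assoc]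
  have hhd : ∀ ν μ, |h ν - h μ| ≤ ‖ν - μ‖ • u := fun ν μ => by
    have hn : ∀ n, |a ν n - a μ n| ≤ ‖ν - μ‖ • u := fun n => by
      refine (hSnw n _ _).trans_eq ?_
      rw [← mul_sub, norm_mul, norm_inv, norm_pow, hl, one_pow, inv_one, one_mul]
    exact abs_le'.2 ⟨le_of_tendsto' ((hh ν).sub (hh μ)) fun n => (le_abs_self _).trans (hn n),
      le_of_tendsto' ((hh ν).sub (hh μ)).neg fun n => (neg_le_abs _).trans (hn n)⟩
  refine ⟨h, fun ν => ?_, hSnh, fun ν => ?_, fun ν => ?_⟩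
  · simpa [ha] using (hmono ν).ge_of_tendsto (hh ν) 0
  · have hb : Tendsto (fun n => ‖l ^ n * ν - ν‖ * ‖u‖) U (𝓝 0) := by
      have := (((hlU.mul_const ν).sub_const ν).norm).mul_const ‖u‖
      simpa using this
    rw [← tendsto_sub_nhds_zero_iff]
    refine squeeze_zero_norm (fun n => ?_) hb
    rw [hSnh]
    have := norm_le_norm_of_abs_le_abs ((hhd (l ^ n * ν) ν).trans (le_abs_self _))
    rwa [norm_smul, norm_norm] at this
  · simpa using ((hh ν).mono_left hU).sub (hdiff ν)

/-- Real form of the theorem: `hrm` and `hmin` make `m` the supremum of `r` over the unit circle, as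
the modulus is for `r ν = re (ν z)`. The condition `hexp` is the ideal inclusion, tested on one
vector with a small error `d`. -/
theorem eq_zero_of_intertwining {S : X →ₗ[ℝ] X} (hS : Monotone S) {C : ℝ}
    (hC : ∀ n x, ‖(S ^ n) x‖ ≤ C * ‖x‖)
    (hwap : ∀ x, ∀ U : Ultrafilter ℕ, ∃ h : X, ∀ φ : StrongDual ℝ X,
      Tendsto (fun n => φ ((S ^ n) x)) U (𝓝 (φ h)))
    (hexp : ∀ x, 0 ≤ x → ∃ n, ∀ ε > 0, ∃ t : ℝ, 0 ≤ t ∧ ∃ d : X, ‖d‖ < ε ∧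
      (S ^ n) x ≤ t • (S ^ (n + 1)) x + d)
    {l : ℂ} (hl : ‖l‖ = 1) (hl1 : l ≠ 1)
    {r : ℂ →ₗ[ℝ] X} (hSr : ∀ ν, S (r ν) = r (l * ν)) {m : X} (hm0 : 0 ≤ m)
    (hrm : ∀ ν, r ν ≤ ‖ν‖ • m) (hmin : ∀ b, (∀ ν, ‖ν‖ = 1 → r ν ≤ b) → m ≤ b) : m = 0 := by
  have hl0 : l ≠ 0 := by rintro rfl; simp at hl
  have hmS : m ≤ S m := hmin _ fun ν hν => by
    have h1 : r ν = S (r (l⁻¹ * ν)) := by rw [hSr, mul_inv_cancel_left₀ hl0]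
    have h2 := hrm (l⁻¹ * ν)
    rw [norm_mul, norm_inv, hl, hν, inv_one, one_mul, one_smul] at h2
    rw [h1]
    exact hS h2
  obtain ⟨u, hmu, hSu, hlim⟩ := exists_fixed_of_le_map hS hC hmS (hwap m)
  have hu0 : 0 ≤ u := hm0.trans hmu
  have hru : ∀ ν, r ν ≤ ‖ν‖ • u := fun ν =>
    (hrm ν).trans (smul_le_smul_of_nonneg_left hmu (norm_nonneg _))
  obtain ⟨U, hU, hlU⟩ := exists_ultrafilter_tendsto_pow_one hl
  set c : ℝ := ‖1 + l‖ / 2 with hc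
  have hc1 : c < 1 := by
    -- Strict convexity of `ℂ`: this is where `l ≠ 1` enters.
    have hlt : ‖1 + l‖ < ‖(1 : ℂ)‖ + ‖l‖ := by
      refine norm_add_lt_of_not_sameRay fun hray => hl1 ?_
      exact (hray.eq_of_norm_eq (by simp [hl])).symm
    rw [norm_one, hl] at hlt
    rw [hc]
    linarith
  obtain ⟨h, hwh, hSh, hSh', hSw⟩ :=
    exists_equivariant_limit hS hC hwap hl hU hlU hSr hu0 hSu hru c
  have hh0 : ∀ ν, 0 ≤ h ν := fun ν => (posPart_nonneg _).trans (hwh ν)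
  have hdisj : ∀ ν, ‖ν‖ = 1 → (r ν - c • u) + (r (l * ν) - c • u) ≤ 0 := fun ν hν => by
    have h1 := hru (ν + l * ν)
    rw [show ν + l * ν = (1 + l) * ν by ring, norm_mul, hν, mul_one] at h1
    have h2 : (r ν - c • u) + (r (l * ν) - c • u) = r ((1 + l) * ν) - ‖1 + l‖ • u := by
      rw [show (1 + l) * ν = ν + l * ν by ring, map_add, hc]
      module
    rw [h2]
    exact sub_nonpos.2 h1
  -- `h ν` cannot be approximated by the ideal generated by `h (l * ν)`
  have hvanish : ∀ ν, ‖ν‖ = 1 → (∀ ε > 0, ∃ t : ℝ, 0 ≤ t ∧ ∃ d : X, ‖d‖ < ε ∧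
      h ν ≤ t • h (l * ν) + d) → h ν = 0 := fun ν hν hap => by
    have hC0 : ∀ ε > 0, ‖h ν‖ ≤ |C| * ε := fun ε hε => by
      obtain ⟨t, ht, d, hd, hle⟩ := hap ε hε
      -- The left side lies below both `(r ν - c • u)⁺` and `t • (r (l * ν) - c • u)⁺`, which are
      -- disjoint. Its correction terms vanish along `U` under `S ^ n`, except for `|d|`, which
      -- costs at most `|C| * ε`.
      have hneg : h ν - (h ν - (r ν - c • u)⁺)
          - t • (h (l * ν) - (r (l * ν) - c • u)⁺) - |d| ≤ 0 := by
        refine nonpos_of_le_posPart_of_le_smul_posPart ht (hdisj ν hν) ?_ ?_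
        · rw [sub_sub_cancel, sub_sub]
          exact sub_le_self _ (add_nonneg (smul_nonneg ht (sub_nonneg.2 (hwh _))) (abs_nonneg _))
        · have h1 : h ν ≤ t • h (l * ν) + |d| := hle.trans (by gcongr; exact le_abs_self d)
          have h2 := sub_nonneg.2 (hwh ν)
          calc _ ≤ t • h (l * ν) + |d| - 0
                - t • (h (l * ν) - (r (l * ν) - c • u)⁺) - |d| := by gcongr
            _ = _ := by module
      set f : ℕ → X := fun n => (S ^ n) (h ν) - (S ^ n) (r ν - c • u)⁺ with hf
      set g : ℕ → X := fun n => (S ^ n) (h (l * ν)) - (S ^ n) (r (l * ν) - c • u)⁺ with hg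
      have hf0 : Tendsto f U (𝓝 0) := by simpa using (hSh' ν).sub (hSw ν)
      have hg0 : Tendsto g U (𝓝 0) := by simpa using (hSh' (l * ν)).sub (hSw (l * ν))
      have hbound : ∀ n, ‖(S ^ n) (h ν)‖ ≤ ‖f n‖ + t * ‖g n‖ + |C| * ε := fun n => by
        have h1 : (S ^ n) (h ν) ≤ f n + t • g n + (S ^ n) |d| := by
          have := monotone_end_pow hS n hneg
          simp only [map_sub, map_smul, map_zero] at this
          rw [← sub_nonpos]
          refine le_of_eq_of_le ?_ this
          simp only [hf, hg]
          abel
        have h2 : 0 ≤ (S ^ n) (h ν) := by rw [hSh]; exact hh0 _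
        refine (norm_le_norm_of_nonneg_of_le h2 h1).trans ?_
        refine (norm_add₃_le).trans ?_
        rw [norm_smul, Real.norm_of_nonneg ht]
        gcongr
        refine (hC n _).trans ?_
        rw [norm_abs_eq_norm]
        exact mul_le_mul (le_abs_self C) hd.le (norm_nonneg _) (abs_nonneg _)
      have := ((hf0.norm).add ((hg0.norm).const_mul t)).add_const (|C| * ε)
      simp only [norm_zero, mul_zero, add_zero, zero_add] at this
      exact le_of_tendsto_of_tendsto' (hSh' ν).norm this hbound
    have h0 : ‖h ν‖ ≤ 0 := by
      refine le_of_forall_pos_le_add fun ε hε => ?_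
      refine (hC0 (ε / (|C| + 1)) (by positivity)).trans ?_
      rw [zero_add, mul_div_assoc', div_le_iff₀ (by positivity)]
      nlinarith [abs_nonneg C]
    exact norm_le_zero_iff.1 h0
  have hhz : ∀ ν, ‖ν‖ = 1 → h ν = 0 := fun ν hν => by
    obtain ⟨n, hn⟩ := hexp (h ν) (hh0 ν)
    have hz : h (l ^ n * ν) = 0 := by
      refine hvanish _ (by simp [hl, hν]) fun ε hε => ?_
      have := hn ε hε
      rwa [hSh, hSh, pow_succ', mul_assoc] at this
    -- The orbit of `h ν` is zero from index `n` on, yet it returns to `h ν` along `U`.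
    refine tendsto_nhds_unique (hSh' ν) (tendsto_const_nhds.congr' ?_)
    filter_upwards [hU (eventually_ge_atTop n)] with k hk
    rw [← Nat.sub_add_cancel hk, pow_add, Module.End.mul_apply, hSh n, hz, map_zero]
  have hmc : m ≤ c • u := hmin _ fun ν hν => by
    have := (le_posPart _).trans ((hwh ν).trans_eq (hhz ν hν))
    exact sub_nonpos.1 this
  have huc : u ≤ c • u := le_of_tendsto' hlim fun n => by
    refine (monotone_end_pow hS n hmc).trans_eq ?_
    rw [map_smul]
    congr 1
    induction n with
    | zero => simp
    | succ n ih => rw [pow_succ, Module.End.mul_apply, hSu, ih]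
  have hu : u ≤ 0 := by
    have h1 : (1 - c) • u ≤ 0 := by
      rw [sub_smul, one_smul]
      exact sub_nonpos.2 huc
    have h2 : 0 < 1 - c := by linarith
    exact (smul_nonpos_iff_nonpos_of_pos_left h2).1 h1
  exact le_antisymm (hmu.trans hu) hm0

end

/-! ### Consequences of weak almost periodicity -/

section

variable {E : Type*} [NormedAddCommGroup E] [NormedSpace ℂ E]

theorem IsWeaklyAlmostPeriodic.exists_tendsto {T : Module.End ℂ E} (hT : IsWeaklyAlmostPeriodic T)
    (f : E) (U : Ultrafilter ℕ) :
    ∃ h : E, ∀ ψ : StrongDual ℂ E, Tendsto (fun n => ψ ((T ^ n) f)) U (𝓝 (ψ h)) := by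
  obtain ⟨h, -, hh⟩ := (hT f).ultrafilter_le_nhds (U.map fun n => toWeakSpace ℂ E ((T ^ n) f))
    (le_principal_iff.2 (mem_map.2 (univ_mem' fun n => subset_closure ⟨_, ⟨n, rfl⟩, rfl⟩)))
  refine ⟨(toWeakSpace ℂ E).symm h, fun ψ => ?_⟩
  exact ((WeakBilin.eval_continuous (topDualPairing ℂ E).flip ψ).tendsto h).comp hh

/-- Each functional is bounded on the weakly compact orbit closure; Banach–Steinhaus in the bidual
then bounds the norms. -/
theorem IsWeaklyAlmostPeriodic.exists_norm_le {T : Module.End ℂ E} (hT : IsWeaklyAlmostPeriodic T)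
    (f : E) : ∃ C, ∀ n, ‖(T ^ n) f‖ ≤ C := by
  obtain ⟨C, hC⟩ := banach_steinhaus
    (g := fun n => NormedSpace.inclusionInDoubleDual ℂ E ((T ^ n) f)) fun ψ => by
      have hc := WeakBilin.eval_continuous (topDualPairing ℂ E).flip ψ
      obtain ⟨C, hC⟩ := (hT f).exists_bound_of_continuousOn hc.continuousOn
      exact ⟨C, fun n => hC _ (subset_closure ⟨_, ⟨n, rfl⟩, rfl⟩)⟩
  refine ⟨C, fun n => ?_⟩
  have h := hC n
  rwa [← (NormedSpace.inclusionInDoubleDualLi (E := E) ℂ).norm_map ((T ^ n) f)]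

end

/-! ### Passage between the complexification and its real part -/

namespace Complexification

theorem ofReal_add {X : Type*} [AddCommGroup X] (x y : X) :
    ofReal (x + y) = ofReal x + ofReal y := by ext <;> simp

section

variable {X : Type*} [AddCommGroup X] [Module ℝ X]

theorem ofReal_smul (a : ℝ) (x : X) : ofReal (a • x) = (a : ℂ) • ofReal x := by
  ext <;> simp [-Complex.coe_smul]

theorem ofReal_re_add_I_smul (z : Complexification X) :
    ofReal z.re + Complex.I • ofReal z.im = z := by ext <;> simp

/-- The real part of the restriction of `T` to `X`. -/
def realPart (T : Module.End ℂ (Complexification X)) : X →ₗ[ℝ] X where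
  toFun x := (T (ofReal x)).re
  map_add' x y := by simp [ofReal_add]
  map_smul' a x := by simp [ofReal_smul, -Complex.coe_smul]

theorem realPart_apply (T : Module.End ℂ (Complexification X)) (x : X) :
    realPart T x = (T (ofReal x)).re := rfl

/-- The real-linear map `ν ↦ re (ν z)`. -/
def reSmul (z : Complexification X) : ℂ →ₗ[ℝ] X where
  toFun ν := (ν • z).re
  map_add' ν μ := by simp [add_smul]
  map_smul' a ν := by simp [smul_sub, mul_smul, -Complex.coe_smul]

theorem reSmul_apply (z : Complexification X) (ν : ℂ) : reSmul z ν = (ν • z).re := rfl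

end

section

variable {X : Type*} [AddCommGroup X] [Lattice X] [IsOrderedAddMonoid X] [Module ℝ X]
  {T : Module.End ℂ (Complexification X)}

theorem monotone_realPart (hpos : ∀ f, 0 ≤ f → 0 ≤ T f) : Monotone (realPart T) := by
  intro x y hxy
  rw [← sub_nonneg, ← map_sub]
  exact (hpos (ofReal (y - x)) ⟨by simpa using hxy, rfl⟩).1

theorem map_ofReal (hpos : ∀ f, 0 ≤ f → 0 ≤ T f) (x : X) :
    T (ofReal x) = ofReal (realPart T x) := by
  have key : ∀ y : X, 0 ≤ y → (T (ofReal y)).im = 0 := fun y hy =>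
    (hpos (ofReal y) ⟨hy, rfl⟩).2.symm
  refine Complexification.ext rfl ?_
  have h : ofReal x = ofReal x⁺ - ofReal x⁻ := by
    ext <;> simp [posPart_sub_negPart]
  rw [h, map_sub, sub_im, key _ (posPart_nonneg x), key _ (negPart_nonneg x), sub_zero, ofReal_im]

theorem pow_map_ofReal (hpos : ∀ f, 0 ≤ f → 0 ≤ T f) (n : ℕ) (x : X) :
    (T ^ n) (ofReal x) = ofReal ((realPart T ^ n) x) := by
  induction n with
  | zero => simp
  | succ n ih => rw [pow_succ', pow_succ', Module.End.mul_apply, Module.End.mul_apply, ih,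
      map_ofReal hpos]

theorem map_re (hpos : ∀ f, 0 ≤ f → 0 ≤ T f) (z : Complexification X) :
    (T z).re = realPart T z.re := by
  conv_lhs => rw [← ofReal_re_add_I_smul z, map_add, map_smul, map_ofReal hpos, map_ofReal hpos]
  simp

end

variable {X : Type*} [NormedAddCommGroup X] [NormedSpace ℝ X] [Lattice X]
    [IsOrderedAddMonoid X] [IsOrderedModule ℝ X] [HasSolidNorm X] [CompleteSpace X]

/-- The complex-linear extension of a real functional. -/
noncomputable def extendFunctional (φ : StrongDual ℝ X) : StrongDual ℂ (Complexification X) :=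
  LinearMap.mkContinuous
    { toFun := fun z => (φ z.re : ℂ) + φ z.im * Complex.I
      map_add' := fun z w => by simp; ring
      map_smul' := fun c z => by apply Complex.ext <;> simp } (2 * ‖φ‖) fun z => by
    have h1 := (φ.le_opNorm z.re).trans (mul_le_mul_of_nonneg_left (norm_re_le z) (norm_nonneg φ))
    have h2 := (φ.le_opNorm z.im).trans (mul_le_mul_of_nonneg_left (norm_im_le z) (norm_nonneg φ))
    refine (norm_add_le _ _).trans ?_
    rw [norm_mul, Complex.norm_I, mul_one, Complex.norm_real, Complex.norm_real]
    linarith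

theorem extendFunctional_re (φ : StrongDual ℝ X) (z : Complexification X) :
    (extendFunctional φ z).re = φ z.re := by
  simp [extendFunctional]

theorem norm_ofReal (x : X) : ‖ofReal x‖ = ‖x‖ := by
  rw [norm_def, modulus_ofReal, norm_abs_eq_norm]

theorem exists_le_smul_add_of_mem_closure {u x : X}
    (h : ofReal x ∈ closure (principalIdeal (ofReal u))) {ε : ℝ} (hε : 0 < ε) :
    ∃ t : ℝ, 0 ≤ t ∧ ∃ d : X, ‖d‖ < ε ∧ x ≤ t • u + d := by
  obtain ⟨w, ⟨t, ht, hw⟩, hd⟩ := Metric.mem_closure_iff.1 h ε hε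
  refine ⟨t, ht, x - w.re, ?_, ?_⟩
  · rw [dist_eq_norm] at hd
    simpa using (norm_re_le _).trans_lt hd
  · have h1 : w.re ≤ t • u := by
      refine (le_abs_self _).trans ((abs_re_le_modulus w).trans ?_)
      simpa [-Complex.coe_smul] using hw.1
    calc x = w.re + (x - w.re) := by abel
      _ ≤ t • u + (x - w.re) := by gcongr

theorem self_mem_principalIdeal {x : X} (hx : 0 ≤ x) : ofReal x ∈ principalIdeal (ofReal x) :=
  ⟨1, zero_le_one, by simp [modulus_ofReal, abs_of_nonneg hx]⟩

end Complexification

open Complexification in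
theorem theorem2p1 {X : Type*} [NormedAddCommGroup X] [NormedSpace ℝ X] [Lattice X]
    [IsOrderedAddMonoid X] [IsOrderedModule ℝ X] [HasSolidNorm X] [CompleteSpace X]
    (T : Module.End ℂ (Complexification X))
    (hpos : ∀ f : Complexification X, 0 ≤ f → 0 ≤ T f)
    (hwap : IsWeaklyAlmostPeriodic T)
    (hexp : ∀ f : Complexification X, 0 ≤ f → ∃ n : ℕ, 1 ≤ n ∧
      closure (Complexification.principalIdeal ((T ^ (n - 1)) f)) ⊆
        closure (Complexification.principalIdeal ((T ^ n) f))) :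
    pointSpectrum T ∩ Metric.sphere (0 : ℂ) 1 ⊆ {1} := by
  rintro l ⟨hl, hl1⟩
  rw [mem_sphere_zero_iff_norm] at hl1
  by_contra hne
  obtain ⟨z, hz⟩ := Module.End.HasEigenvalue.exists_hasEigenvector hl
  have hS := monotone_realPart hpos
  obtain ⟨C, hC⟩ := exists_forall_norm_le_of_monotone (S := fun n => realPart T ^ n)
    (fun n => monotone_end_pow hS n) fun x => by
      obtain ⟨C, hC⟩ := hwap.exists_norm_le (ofReal x)
      refine ⟨C, fun n => ?_⟩
      have := hC n
      rwa [pow_map_ofReal hpos, norm_ofReal] at this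
  have hm : z.modulus = 0 := by
    refine eq_zero_of_intertwining hS hC (fun x U => ?_) (fun x hx => ?_) hl1 hne
      (r := reSmul z) (fun ν => ?_) (modulus_nonneg z) (fun ν => ?_) fun b hb => ?_
    · obtain ⟨h, hh⟩ := hwap.exists_tendsto (ofReal x) U
      refine ⟨h.re, fun φ => ?_⟩
      have := (Complex.continuous_re.tendsto _).comp (hh (extendFunctional φ))
      simpa [Function.comp_def, extendFunctional_re, pow_map_ofReal hpos] using this
    · obtain ⟨n, hn, hsub⟩ := hexp (ofReal x) ⟨hx, rfl⟩
      -- The hypothesis compares the powers `n - 1` and `n`, whereas the real form compares `n` and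
      -- `n + 1`.
      refine ⟨n - 1, fun ε hε => ?_⟩
      rw [pow_map_ofReal hpos, pow_map_ofReal hpos] at hsub
      rw [Nat.sub_add_cancel hn]
      refine exists_le_smul_add_of_mem_closure (hsub (subset_closure ?_)) hε
      exact self_mem_principalIdeal (by simpa using monotone_end_pow hS (n - 1) hx)
    · rw [reSmul_apply, reSmul_apply, ← map_re hpos, map_smul, hz.apply_eq_smul, smul_smul,
        mul_comm]
    · exact (le_abs_self _).trans ((abs_re_le_modulus _).trans (modulus_smul_le ν z))
    · refine modulus_le fun θ => ?_
      -- The real part of `e^{-iθ} z` is `z.rot θ`, so a bound over unit `ν` bounds the modulus.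
      have := hb (Complex.exp ((-θ : ℝ) * Complex.I)) (Complex.norm_exp_ofReal_mul_I _)
      rw [reSmul_apply, smul_re, Complex.exp_ofReal_mul_I_re, Complex.exp_ofReal_mul_I_im,
        Real.cos_neg, Real.sin_neg, neg_smul, sub_neg_eq_add] at this
      exact this
  refine hz.2 (norm_eq_zero.1 ?_)
  rw [norm_def, hm, _root_.norm_zero]
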